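/- Let $X$ be a Banach space over $\mathbb{K}\in\{\mathbb{R},\mathbb{C}\}$ which does not contain $c_0$, i.e. no subspace of $X$ is isomorphic (linearly homeomorphic) to the Banach space $c_0$ of $\mathbb{K}$-valued null sequences with the supremum norm. Let $d\ge 2$ be an integer, let $\mathbb{N}^*=\{1,2,3,\dots\}$, and let $(r_k)_{k\in(\mathbb{N}^*)^d}$ be a family of independent Rademacher variables on a probability space $\Omega_0$ (each $r_k$ takes each of the values $1$ and $-1$ with probability $1/2$). Let $\mathrm{Rad}((\mathbb{N}^*)^d;X)$ denote the closure in the Bochner space $L_2(\Omega_0;X)$ of the linear span of the elements $r_k\otimes y\colon \omega\mapsto r_k(\omega)\,y$ with $k\in(\mathbb{N}^*)^d$ and $y\in X$, equipped with the norm of $L_2(\Omega_0;X)$. Let $(x_k)_{k\in(\mathbb{N}^*)^d}$ be a family of elements of $X$, and suppose that there exists a constant $K\ge 0$ such that $$\Big\|\sum_{k\in\{1,\dots,N\}^d} r_k\otimes x_k\Big\|_{\mathrm{Rad}((\mathbb{N}^*)^d;X)}\le K\qquad\text{for all } N\in\mathbb{N}^*.$$ Then the family $(r_k\otimes x_k)_{k\in(\mathbb{N}^*)^d}$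 is (unconditionally) summable in $\mathrm{Rad}((\mathbb{N}^*)^d;X)$. -/

import Mathlib

open MeasureTheory ProbabilityTheory
open scoped ENNReal ZeroAtInfty

/-- The normed space `X` contains `c₀`: it has a linear subspace which is isomorphic, as a
topological vector space, to the Banach space `C₀(ℕ, 𝕜)` of null sequences with the supremum norm.
(Such a subspace is complete, hence automatically closed.) -/
def ContainsC0 (𝕜 : Type*) [RCLike 𝕜] (X : Type*) [NormedAddCommGroup X] [NormedSpace 𝕜 X] :
    Prop :=
  ∃ Y : Submodule 𝕜 X, Nonempty (C₀(ℕ, 𝕜) ≃L[𝕜] Y)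

/-- `(r i)` is a family of independent Rademacher variables on `(Ω, μ)`: independent random
variables, each taking the values `1` and `-1` with probability `1/2`. -/
structure IsRademacherFamily {ι Ω : Type*} [MeasurableSpace Ω] (r : ι → Ω → ℝ) (μ : Measure Ω) :
    Prop where
  measurable : ∀ i, Measurable (r i)
  indep : iIndepFun r μ
  prob_one : ∀ i, μ {ω | r i ω = 1} = 1 / 2
  prob_neg_one : ∀ i, μ {ω | r i ω = -1} = 1 / 2

namespace IsRademacherFamily

variable {ι Ω : Type*} [MeasurableSpace Ω] {r : ι → Ω → ℝ} {μ : Measure Ω}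

theorem ae_eq_or [IsProbabilityMeasure μ] (hr : IsRademacherFamily r μ) (i : ι) :
    ∀ᵐ ω ∂μ, r i ω = 1 ∨ r i ω = -1 := by
  have h1 : MeasurableSet {ω | r i ω = 1} := hr.measurable i (measurableSet_singleton 1)
  have h2 : MeasurableSet {ω | r i ω = -1} := hr.measurable i (measurableSet_singleton (-1))
  have hd : Disjoint {ω | r i ω = 1} {ω | r i ω = -1} := by
    rw [Set.disjoint_left]
    intro ω (h : r i ω = 1) (h' : r i ω = -1)
    linarith
  have hu : μ ({ω | r i ω = 1} ∪ {ω | r i ω = -1}) = 1 := by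
    rw [measure_union hd h2, hr.prob_one, hr.prob_neg_one, ENNReal.add_halves]
  exact (prob_compl_eq_zero_iff (h1.union h2)).2 hu

theorem memLp_smul [IsProbabilityMeasure μ] (hr : IsRademacherFamily r μ)
    {𝕜 : Type*} [RCLike 𝕜] {X : Type*} [NormedAddCommGroup X] [NormedSpace 𝕜 X]
    (i : ι) (x : X) : MemLp (fun ω => (r i ω : 𝕜) • x) 2 μ := by
  have hm : AEStronglyMeasurable (fun ω => (r i ω : 𝕜) • x) μ :=
    ((RCLike.continuous_ofReal.measurable.comp (hr.measurable i)).stronglyMeasurable.smul_const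
      x).aestronglyMeasurable
  refine MemLp.of_bound hm ‖x‖ ?_
  filter_upwards [hr.ae_eq_or i] with ω hω
  rcases hω with h | h <;> simp [h]

end IsRademacherFamily

section Rad

variable {ι Ω : Type*} [MeasurableSpace Ω] {r : ι → Ω → ℝ} {μ : Measure Ω} [IsProbabilityMeasure μ]
  (𝕜 : Type*) [RCLike 𝕜] (X : Type*) [NormedAddCommGroup X] [NormedSpace 𝕜 X]

/-- The class of `ω ↦ r i ω • x` in the Bochner space `L²(Ω; X)`. -/
noncomputable def radTensorLp {X : Type*} [NormedAddCommGroup X] [NormedSpace 𝕜 X]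
    (hr : IsRademacherFamily r μ) (i : ι) (x : X) : Lp X 2 μ :=
  (hr.memLp_smul (𝕜 := 𝕜) i x).toLp (fun ω => (r i ω : 𝕜) • x)

/-- The space `Rad(ι; X)`: the closure in `L²(Ω; X)` of the linear span of the elements
`r i ⊗ x`, with the norm of `L²(Ω; X)`. -/
noncomputable def Rad (hr : IsRademacherFamily r μ) : Submodule 𝕜 (Lp X 2 μ) :=
  (Submodule.span 𝕜 {f | ∃ (i : ι) (x : X), f = radTensorLp 𝕜 hr i x}).topologicalClosure

/-- The element `r i ⊗ x` of `Rad(ι; X)`. -/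
noncomputable def radTensor {X : Type*} [NormedAddCommGroup X] [NormedSpace 𝕜 X]
    (hr : IsRademacherFamily r μ) (i : ι) (x : X) : Rad 𝕜 X hr :=
  ⟨radTensorLp 𝕜 hr i x,
    Submodule.le_topologicalClosure _ (Submodule.subset_span ⟨i, x, rfl⟩)⟩

end Rad

/-! By the contraction principle, a bound over cubes bounds all finite Rademacher sums. In the
complete space `Rad` it remains to prove a Cauchy criterion: sums over finite sets far out are small
in L². This is the Hoffmann-Jørgensen–Kwapień theorem, and of the index set it uses only infinitude.

Suppose the criterion fails. Boundedness upgrades blocks that do not vanish in L² to blocks that do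
not vanish in L¹ (`exists_le_integral_norm_signSum`). Multiplying disjoint blocks by signs preserves
their joint law, so freezing a suitable ω in the blocks yields vectors of X, infinitely many of norm
bounded below, whose Rademacher series is bounded in L² (`exists_bounded_series_of_blocks`).

Kwapień's argument extracts a subsequence with uniformly bounded signed sums
(`exists_injective_bounded_sign_sums`). The events that the partial sums have norm at most C have
probability at least 3/4. By Bessel they are nearly uncorrelated with all but finitely many signs,
so signs can be prescribed one after another while the conditional probabilities stay above 1/2.
Averaging over a flip of the remaining signs then removes them. Finally, Bessaga–Pełczyński
(`containsC0_of_bounded_sign_sums`) produces a copy of c₀, a contradiction. -/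

/-- A Rademacher family all of whose values are `±1`, with no exceptional null set. -/
structure IsSignFamily {ι Ω : Type*} [MeasurableSpace Ω] (r : ι → Ω → ℝ) (μ : Measure Ω) :
    Prop extends IsRademacherFamily r μ where
  eq_or : ∀ i ω, r i ω = 1 ∨ r i ω = -1

/-! ### Signed sums and sign flips -/

/-- The signed sum `∑ i ∈ F, v i • x i`. -/
def signSum (𝕜 : Type*) [RCLike 𝕜] {ι X : Type*} [NormedAddCommGroup X] [NormedSpace 𝕜 X]
    (x : ι → X) (F : Finset ι) (v : ι → ℝ) : X :=
  ∑ i ∈ F, (v i : 𝕜) • x i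

section SignSum

variable {𝕜 : Type*} [RCLike 𝕜] {ι X : Type*} [NormedAddCommGroup X] [NormedSpace 𝕜 X]
  {x : ι → X} {F : Finset ι}

theorem stronglyMeasurable_signSum : StronglyMeasurable (signSum 𝕜 x F) :=
  Finset.stronglyMeasurable_fun_sum F fun i _ =>
    (RCLike.continuous_ofReal.measurable.comp (measurable_pi_apply i)).stronglyMeasurable.smul_const
      (x i)

theorem norm_signSum_le {v : ι → ℝ} (hv : ∀ i, v i = 1 ∨ v i = -1) :
    ‖signSum 𝕜 x F v‖ ≤ ∑ i ∈ F, ‖x i‖ := by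
  refine (norm_sum_le _ _).trans (Finset.sum_le_sum fun i _ => ?_)
  rcases hv i with h | h <;> simp [h]

theorem signSum_congr {v w : ι → ℝ} (h : ∀ i ∈ F, v i = w i) :
    signSum 𝕜 x F v = signSum 𝕜 x F w :=
  Finset.sum_congr rfl fun i hi => by rw [h i hi]

/-- Averaging over a flip of the signs outside `F` projects onto the sum over `F`. -/
theorem signSum_add_signSum_flip {G : Finset ι} (hFG : F ⊆ G) (v s : ι → ℝ)
    (hF : ∀ i ∈ F, s i = 1) (hG : ∀ i ∈ G, i ∉ F → s i = -1) :
    signSum 𝕜 x G v + signSum 𝕜 x G (fun i => s i * v i) = (2 : 𝕜) • signSum 𝕜 x F v := by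
  classical
  unfold signSum
  rw [← Finset.sum_add_distrib, ← Finset.sum_sdiff hFG, Finset.smul_sum]
  rw [Finset.sum_eq_zero, zero_add]
  · refine Finset.sum_congr rfl fun i hi => ?_
    simp only [hF i hi, one_mul, two_smul]
  · intro i hi
    simp [hG i (Finset.mem_sdiff.1 hi).1 (Finset.mem_sdiff.1 hi).2]

theorem norm_signSum_le_flip {G : Finset ι} (hFG : F ⊆ G) (v s : ι → ℝ)
    (hF : ∀ i ∈ F, s i = 1) (hG : ∀ i ∈ G, i ∉ F → s i = -1) :
    2 * ‖signSum 𝕜 x F v‖ ≤ ‖signSum 𝕜 x G v‖ + ‖signSum 𝕜 x G (fun i => s i * v i)‖ := by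
  have := norm_add_le (signSum 𝕜 x G v) (signSum 𝕜 x G (fun i => s i * v i))
  rw [signSum_add_signSum_flip hFG v s hF hG, norm_smul] at this
  simpa using this

end SignSum

/-! ### Flip invariance, contraction principle and Bessel's inequality -/

namespace IsSignFamily

variable {ι Ω : Type*} [MeasurableSpace Ω] {r : ι → Ω → ℝ} {μ : Measure Ω}

theorem comp_injective (hr : IsSignFamily r μ) {κ : Type*} {e : κ → ι}
    (he : Function.Injective e) : IsSignFamily (fun k => r (e k)) μ where
  measurable k := hr.measurable (e k)
  indep := hr.indep.precomp he
  prob_one k := hr.prob_one (e k)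
  prob_neg_one k := hr.prob_neg_one (e k)
  eq_or k := hr.eq_or (e k)

theorem measurable_pi (hr : IsSignFamily r μ) : Measurable fun ω i => r i ω :=
  measurable_pi_lambda _ hr.measurable

theorem map_eq (hr : IsSignFamily r μ) (i : ι) :
    μ.map (r i) = (1 / 2 : ℝ≥0∞) • Measure.dirac 1 + (1 / 2 : ℝ≥0∞) • Measure.dirac (-1) := by
  have h1 : MeasurableSet {ω | r i ω = 1} := hr.measurable i (measurableSet_singleton 1)
  have hc : {ω | r i ω = 1}ᶜ = {ω | r i ω = -1} := by
    ext ω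
    rcases hr.eq_or i ω with h | h <;> simp [h] <;> norm_num
  classical
  ext B hB
  rw [Measure.map_apply (hr.measurable i) hB, ← measure_inter_add_sdiff _ h1, Set.sdiff_eq, hc]
  have e : ∀ c : ℝ, r i ⁻¹' B ∩ {ω | r i ω = c} = if c ∈ B then {ω | r i ω = c} else ∅ := by
    intro c
    split_ifs with h
    · ext ω; simp only [Set.mem_inter_iff, Set.mem_preimage, Set.mem_ofPred_eq]
      exact ⟨fun h => h.2, fun h' => ⟨h' ▸ h, h'⟩⟩
    · ext ω; simp only [Set.mem_inter_iff, Set.mem_preimage, Set.mem_ofPred_eq,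
        Set.mem_empty_iff_false, iff_false]
      exact fun h' => h (h'.2 ▸ h'.1)
  rw [e, e]
  simp only [Measure.coe_add, Measure.coe_smul, Pi.add_apply, Pi.smul_apply, smul_eq_mul,
    Measure.dirac_apply' _ hB, Set.indicator_apply, Pi.one_apply]
  congr 1 <;> split_ifs <;> simp [hr.prob_one, hr.prob_neg_one]

theorem flip (hr : IsSignFamily r μ) {s : ι → ℝ} (hs : ∀ i, s i = 1 ∨ s i = -1) :
    IsSignFamily (fun i ω => s i * r i ω) μ where
  measurable i := (hr.measurable i).const_mul (s i)
  indep := hr.indep.comp (fun i t => s i * t) fun i => measurable_const_mul (s i)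
  prob_one i := by
    rcases hs i with h | h
    · simp [h, hr.prob_one]
    · simp [h, hr.prob_neg_one, neg_eq_iff_eq_neg]
  prob_neg_one i := by
    rcases hs i with h | h
    · simp [h, hr.prob_neg_one]
    · simp [h, hr.prob_one]
  eq_or i ω := by
    rcases hs i with h | h <;> rcases hr.eq_or i ω with h' | h' <;> simp [h, h']

variable [IsProbabilityMeasure μ]

/-- Independence makes the joint law the product of the coordinate laws, and each of these is
symmetric. -/
theorem map_pi_flip (hr : IsSignFamily r μ) {s : ι → ℝ} (hs : ∀ i, s i = 1 ∨ s i = -1) :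
    μ.map (fun ω i => s i * r i ω) = μ.map (fun ω i => r i ω) := by
  have h1 := (iIndepFun_iff_map_fun_eq_infinitePi_map fun i => hr.measurable i).1 hr.indep
  have h2 := (iIndepFun_iff_map_fun_eq_infinitePi_map fun i =>
    (hr.flip hs).measurable i).1 (hr.flip hs).indep
  rw [h1, h2]
  simp only [hr.map_eq, (hr.flip hs).map_eq]

theorem integral_flip (hr : IsSignFamily r μ) {s : ι → ℝ} (hs : ∀ i, s i = 1 ∨ s i = -1)
    {g : (ι → ℝ) → ℝ} (hg : Measurable g) :
    ∫ ω, g (fun i => s i * r i ω) ∂μ = ∫ ω, g (fun i => r i ω) ∂μ := by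
  rw [← integral_map hr.measurable_pi.aemeasurable hg.aestronglyMeasurable, ← hr.map_pi_flip hs,
    integral_map (hr.flip hs).measurable_pi.aemeasurable hg.aestronglyMeasurable]

theorem integrable_of_le (hr : IsSignFamily r μ) {g : (ι → ℝ) → ℝ} (hg : Measurable g) {C : ℝ}
    (hC : ∀ v : ι → ℝ, (∀ i, v i = 1 ∨ v i = -1) → |g v| ≤ C) :
    Integrable (fun ω => g (fun i => r i ω)) μ :=
  Integrable.of_bound (hg.comp hr.measurable_pi).aestronglyMeasurable C
    (Filter.Eventually.of_forall fun ω => hC _ fun i => hr.eq_or i ω)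

variable {𝕜 : Type*} [RCLike 𝕜] {X : Type*} [NormedAddCommGroup X] [NormedSpace 𝕜 X]

theorem integrable_norm_signSum (hr : IsSignFamily r μ) (x : ι → X) (F : Finset ι) :
    Integrable (fun ω => ‖signSum 𝕜 x F (fun i => r i ω)‖) μ :=
  hr.integrable_of_le stronglyMeasurable_signSum.norm.measurable fun v hv => by
    rw [abs_norm]; exact norm_signSum_le hv

theorem integrable_norm_signSum_sq (hr : IsSignFamily r μ) (x : ι → X) (F : Finset ι) :
    Integrable (fun ω => ‖signSum 𝕜 x F (fun i => r i ω)‖ ^ 2) μ :=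
  hr.integrable_of_le (stronglyMeasurable_signSum.norm.measurable.pow_const 2) fun v hv => by
    rw [abs_of_nonneg (by positivity)]
    exact pow_le_pow_left₀ (norm_nonneg _) (norm_signSum_le hv) 2

/-- The contraction principle: Rademacher averages decrease when passing to a subfamily. -/
theorem integral_norm_signSum_sq_mono (hr : IsSignFamily r μ) (x : ι → X) {F G : Finset ι}
    (hFG : F ⊆ G) :
    ∫ ω, ‖signSum 𝕜 x F (fun i => r i ω)‖ ^ 2 ∂μ ≤ ∫ ω, ‖signSum 𝕜 x G (fun i => r i ω)‖ ^ 2 ∂μ := by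
  classical
  set s : ι → ℝ := fun i => if i ∈ F then 1 else -1 with hs
  have hs1 : ∀ i, s i = 1 ∨ s i = -1 := fun i => by
    by_cases h : i ∈ F <;> simp [hs, h]
  have h1 := hr.integral_flip hs1
    ((stronglyMeasurable_signSum (𝕜 := 𝕜) (x := x) (F := G)).norm.measurable.pow_const 2)
  have h2 := (hr.flip hs1).integrable_norm_signSum_sq (𝕜 := 𝕜) x G
  have h3 := hr.integrable_norm_signSum_sq (𝕜 := 𝕜) x G
  have h4 : ∫ ω, 2 * ‖signSum 𝕜 x F (fun i => r i ω)‖ ^ 2 ∂μ ≤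
      ∫ ω, (‖signSum 𝕜 x G (fun i => r i ω)‖ ^ 2 +
        ‖signSum 𝕜 x G (fun i => s i * r i ω)‖ ^ 2) ∂μ := by
    refine integral_mono ((hr.integrable_norm_signSum_sq x F).const_mul 2) (h3.add h2) fun ω => ?_
    have := norm_signSum_le_flip (𝕜 := 𝕜) (x := x) hFG (fun i => r i ω) s
      (fun i hi => by simp [hs, hi]) (fun i _ hi => by simp [hs, hi])
    have h0 := norm_nonneg (signSum 𝕜 x F (fun i => r i ω))
    simp only
    -- With 2f ≤ a + b, this is 4f² ≤ (a + b)² ≤ 2a² + 2b².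
    nlinarith [sq_nonneg (‖signSum 𝕜 x G (fun i => r i ω)‖ -
      ‖signSum 𝕜 x G (fun i => s i * r i ω)‖)]
  rw [integral_add h3 h2, integral_const_mul] at h4
  linarith

/-- Flipping the sign `i` alone preserves the law and negates the product. -/
theorem integral_mul_eq_zero (hr : IsSignFamily r μ) {i j : ι} (hij : i ≠ j) :
    ∫ ω, r i ω * r j ω ∂μ = 0 := by
  classical
  have := hr.integral_flip (s := fun k => if k = i then -1 else 1)
    (fun k => by by_cases h : k = i <;> simp [h])
    (g := fun v => v i * v j) ((measurable_pi_apply i).mul (measurable_pi_apply j))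
  simp only [if_true, if_neg hij.symm, neg_mul, one_mul, integral_neg] at this
  linarith

/-- Bessel's inequality for a bounded function and distinct signs. -/
theorem sum_integral_mul_sq_le (hr : IsSignFamily r μ) {h : Ω → ℝ} (hm : Measurable h) {C : ℝ}
    (hC : ∀ ω, |h ω| ≤ C) (F : Finset ι) :
    ∑ i ∈ F, (∫ ω, h ω * r i ω ∂μ) ^ 2 ≤ C ^ 2 := by
  set a : ι → ℝ := fun i => ∫ ω, h ω * r i ω ∂μ with ha
  have habs : ∀ i ω, |r i ω| = 1 := fun i ω => by rcases hr.eq_or i ω with h | h <;> simp [h]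
  have hi1 : ∀ i, Integrable (fun ω => h ω * r i ω) μ := fun i =>
    Integrable.of_bound (hm.mul (hr.measurable i)).aestronglyMeasurable C
      (Filter.Eventually.of_forall fun ω => by
        rw [Real.norm_eq_abs, abs_mul, habs, mul_one]; exact hC ω)
  have hi2 : ∀ i j, Integrable (fun ω => r i ω * r j ω) μ := fun i j =>
    Integrable.of_bound ((hr.measurable i).mul (hr.measurable j)).aestronglyMeasurable 1
      (Filter.Eventually.of_forall fun ω => by
        rw [Real.norm_eq_abs, abs_mul, habs, habs, mul_one])
  have hi3 : Integrable (fun ω => h ω ^ 2) μ :=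
    Integrable.of_bound (hm.pow_const 2).aestronglyMeasurable (C ^ 2)
      (Filter.Eventually.of_forall fun ω => by
        rw [Real.norm_eq_abs, abs_pow]
        exact pow_le_pow_left₀ (abs_nonneg _) (hC ω) 2)
  -- The residual of `h` after subtracting its Rademacher components has nonnegative energy;
  -- orthonormality of the signs collapses the double sum.
  have key : ∫ ω, (h ω - ∑ i ∈ F, a i * r i ω) ^ 2 ∂μ =
      ∫ ω, h ω ^ 2 ∂μ - ∑ i ∈ F, a i ^ 2 := by
    have e : ∀ ω, (h ω - ∑ i ∈ F, a i * r i ω) ^ 2 = h ω ^ 2 - ∑ i ∈ F, 2 * a i * (h ω * r i ω) +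
        ∑ i ∈ F, ∑ j ∈ F, a i * a j * (r i ω * r j ω) := by
      intro ω
      rw [sub_sq, sq (∑ i ∈ F, a i * r i ω), Finset.sum_mul_sum, Finset.mul_sum]
      refine congrArg₂ (· + ·) (congrArg₂ (· - ·) rfl ?_) ?_
      · exact Finset.sum_congr rfl fun i _ => by ring
      · exact Finset.sum_congr rfl fun i _ => Finset.sum_congr rfl fun j _ => by ring
    have hi4 : Integrable (fun ω => ∑ i ∈ F, 2 * a i * (h ω * r i ω)) μ :=
      integrable_finsetSum _ fun i _ => (hi1 i).const_mul _
    have hi5 : ∀ i, Integrable (fun ω => ∑ j ∈ F, a i * a j * (r i ω * r j ω)) μ := fun i =>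
      integrable_finsetSum _ fun j _ => (hi2 i j).const_mul _
    have hi6 : Integrable (fun ω => h ω ^ 2 - ∑ i ∈ F, 2 * a i * (h ω * r i ω)) μ := hi3.sub hi4
    simp only [e]
    rw [integral_add hi6 (integrable_finsetSum _ fun i _ => hi5 i), integral_sub hi3 hi4,
      integral_finsetSum _ fun i _ => (hi1 i).const_mul _, integral_finsetSum _ fun i _ => hi5 i]
    have e2 : ∀ i ∈ F, ∫ ω, ∑ j ∈ F, a i * a j * (r i ω * r j ω) ∂μ = a i ^ 2 := by
      intro i hi
      rw [integral_finsetSum _ fun j _ => (hi2 i j).const_mul _, Finset.sum_eq_single i]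
      · rw [integral_const_mul]
        have : ∀ ω, r i ω * r i ω = 1 := fun ω => by rw [← abs_mul_abs_self, habs, mul_one]
        simp [this, sq]
      · intro j _ hj
        rw [integral_const_mul, hr.integral_mul_eq_zero hj.symm, mul_zero]
      · exact fun h => absurd hi h
    rw [Finset.sum_congr rfl e2]
    simp only [integral_const_mul]
    rw [Finset.sum_congr rfl (g := fun i => 2 * a i ^ 2) fun i _ => by simp only [ha]; ring,
      ← Finset.mul_sum]
    ring
  have h0 : 0 ≤ ∫ ω, (h ω - ∑ i ∈ F, a i * r i ω) ^ 2 ∂μ := integral_nonneg fun ω => sq_nonneg _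
  have h1 : ∫ ω, h ω ^ 2 ∂μ ≤ ∫ _, C ^ 2 ∂μ :=
    integral_mono hi3 (integrable_const _) fun ω => by
      rw [← sq_abs]; exact pow_le_pow_left₀ (abs_nonneg _) (hC ω) 2
  simp only [integral_const, probReal_univ, one_smul] at h1
  linarith

end IsSignFamily

/-! ### Freezing the blocks -/

/-- Measurable sets of measure bounded below have a common point in infinitely many of them. -/
theorem MeasureTheory.exists_frequently_mem_of_le_measureReal {Ω : Type*} [MeasurableSpace Ω]
    {μ : Measure Ω} [IsFiniteMeasure μ]
    {E : ℕ → Set Ω} (hE : ∀ n, MeasurableSet (E n)) {p : ℝ} (hp : 0 < p)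
    (h : ∀ n, p ≤ μ.real (E n)) :
    ∃ ω, ∃ᶠ n in Filter.atTop, ω ∈ E n := by
  have hm : ∀ m, MeasurableSet (⋃ n, ⋃ (_ : m ≤ n), E n) := fun m =>
    MeasurableSet.iUnion fun n => MeasurableSet.iUnion fun _ => hE n
  -- The tail unions decrease to the limsup set, which therefore keeps measure at least `p` and is
  -- nonempty.
  have hlim := tendsto_measure_iInter_atTop (μ := μ) (s := fun m => ⋃ n, ⋃ (_ : m ≤ n), E n)
    (fun m => (hm m).nullMeasurableSet)
    (fun a b hab => Set.iUnion_mono fun n => Set.iUnion_mono' fun hn => ⟨hab.trans hn, le_rfl⟩)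
    ⟨0, measure_ne_top _ _⟩
  have h1 : ENNReal.ofReal p ≤ μ (⋂ m, ⋃ n, ⋃ (_ : m ≤ n), E n) := by
    refine ge_of_tendsto' hlim fun m => ?_
    refine le_trans ?_ (measure_mono (Set.subset_iUnion₂ (s := fun n (_ : m ≤ n) => E n) m le_rfl))
    exact ENNReal.ofReal_le_of_le_toReal (h m)
  obtain ⟨ω, hω⟩ := nonempty_of_measure_ne_zero
    (ne_of_gt ((ENNReal.ofReal_pos.2 hp).trans_le h1))
  refine ⟨ω, Filter.frequently_atTop.2 fun m => ?_⟩
  simp only [Set.mem_iInter, Set.mem_iUnion] at hω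
  obtain ⟨n, hn, hn'⟩ := hω m
  exact ⟨n, hn, hn'⟩

namespace IsSignFamily

variable {ι Ω : Type*} [MeasurableSpace Ω] {r : ι → Ω → ℝ} {μ : Measure Ω} [IsProbabilityMeasure μ]
  {𝕜 : Type*} [RCLike 𝕜] {X : Type*} [NormedAddCommGroup X] [NormedSpace 𝕜 X]

/-- If bounded Rademacher sums do not vanish at infinity in `L²`, then they do not vanish at
infinity in `L¹`. -/
theorem exists_le_integral_norm_signSum (hr : IsSignFamily r μ) (x : ι → X) {K δ : ℝ}
    (hK : ∀ F : Finset ι, ∫ ω, ‖signSum 𝕜 x F (fun i => r i ω)‖ ^ 2 ∂μ ≤ K) (hδ : 0 < δ)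
    (h : ∀ G : Finset ι, ∃ F, Disjoint F G ∧
      δ ≤ ∫ ω, ‖signSum 𝕜 x F (fun i => r i ω)‖ ^ 2 ∂μ) :
    ∃ δ' > 0, ∀ G : Finset ι, ∃ F, Disjoint F G ∧
      δ' ≤ ∫ ω, ‖signSum 𝕜 x F (fun i => r i ω)‖ ∂μ := by
  classical
  by_contra! hcon
  -- If the L¹ averages vanished at infinity, the cross terms would be negligible, so each new block
  -- would add at least δ/2 to the energy and the bound `K` would be exceeded.
  have key : ∀ n : ℕ, ∃ W, n * (δ / 2) ≤ ∫ ω, ‖signSum 𝕜 x W (fun i => r i ω)‖ ^ 2 ∂μ := by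
    intro n
    induction n with
    | zero => exact ⟨∅, by simp [signSum]⟩
    | succ n ih =>
      obtain ⟨W, hW⟩ := ih
      set C := ∑ i ∈ W, ‖x i‖ with hC
      have hC0 : 0 ≤ C := Finset.sum_nonneg fun _ _ => norm_nonneg _
      -- This threshold makes the cross term 2C ∫ ‖F-block‖ at most δ/2.
      obtain ⟨G, hG⟩ := hcon (δ / (4 * (C + 1))) (by positivity)
      obtain ⟨F, hFd, hF⟩ := h (G ∪ W)
      rw [Finset.disjoint_union_right] at hFd
      have h1 := hG F hFd.1
      refine ⟨W ∪ F, ?_⟩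
      have hadd : Integrable (fun ω => ‖signSum 𝕜 x W (fun i => r i ω)‖ ^ 2 +
          ‖signSum 𝕜 x F (fun i => r i ω)‖ ^ 2) μ :=
        (hr.integrable_norm_signSum_sq x W).add (hr.integrable_norm_signSum_sq x F)
      have h2 : ∫ ω, (‖signSum 𝕜 x W (fun i => r i ω)‖ ^ 2 +
          ‖signSum 𝕜 x F (fun i => r i ω)‖ ^ 2 -
          2 * C * ‖signSum 𝕜 x F (fun i => r i ω)‖) ∂μ ≤
          ∫ ω, ‖signSum 𝕜 x (W ∪ F) (fun i => r i ω)‖ ^ 2 ∂μ := by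
        refine integral_mono (hadd.sub ((hr.integrable_norm_signSum x F).const_mul _))
          (hr.integrable_norm_signSum_sq x _) fun ω => ?_
        have e : signSum 𝕜 x (W ∪ F) (fun i => r i ω) =
            signSum 𝕜 x W (fun i => r i ω) + signSum 𝕜 x F (fun i => r i ω) :=
          Finset.sum_union hFd.2.symm
        have h3 := norm_signSum_le (𝕜 := 𝕜) (x := x) (F := W) fun i => hr.eq_or i ω
        have h4 := abs_norm_sub_norm_le (signSum 𝕜 x W (fun i => r i ω))
          (-signSum 𝕜 x F (fun i => r i ω))
        rw [norm_neg, sub_neg_eq_add, ← e] at h4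
        have h5 := sq_le_sq' (by
          linarith [abs_nonneg (‖signSum 𝕜 x W (fun i => r i ω)‖ -
            ‖signSum 𝕜 x F (fun i => r i ω)‖), norm_nonneg (signSum 𝕜 x (W ∪ F)
              (fun i => r i ω))]) h4
        rw [sq_abs] at h5
        have h6 := mul_le_mul_of_nonneg_right h3 (norm_nonneg (signSum 𝕜 x F (fun i => r i ω)))
        simp only
        nlinarith
      rw [integral_sub hadd ((hr.integrable_norm_signSum x F).const_mul _),
        integral_add (hr.integrable_norm_signSum_sq x W) (hr.integrable_norm_signSum_sq x F),
        integral_const_mul] at h2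
      have h7 : 2 * C * ∫ ω, ‖signSum 𝕜 x F (fun i => r i ω)‖ ∂μ ≤ δ / 2 := by
        calc _ ≤ 2 * C * (δ / (4 * (C + 1))) := by gcongr
          _ ≤ δ / 2 := by
            rw [mul_div_assoc', div_le_div_iff₀ (by positivity) (by positivity)]
            nlinarith
      push_cast
      linarith
  obtain ⟨n, hn⟩ := exists_nat_gt (K / (δ / 2))
  obtain ⟨W, hW⟩ := key n
  rw [div_lt_iff₀ (by positivity)] at hn
  linarith [hK W]

/-- Freezing the blocks: from disjoint blocks of a bounded Rademacher series which do not tend to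
`0` in `L¹`, one obtains a bounded Rademacher series in `X` whose terms do not tend to `0`. -/
theorem exists_bounded_series_of_blocks (hr : IsSignFamily r μ) (x : ι → X) {K δ : ℝ}
    (hK : ∀ F : Finset ι, ∫ ω, ‖signSum 𝕜 x F (fun i => r i ω)‖ ^ 2 ∂μ ≤ K) (hδ : 0 < δ)
    {F : ℕ → Finset ι} (hd : Pairwise (Function.onFun Disjoint F))
    (hF : ∀ n, δ ≤ ∫ ω, ‖signSum 𝕜 x (F n) (fun i => r i ω)‖ ∂μ)
    {ρ : ℕ → Ω → ℝ} (hρ : IsSignFamily ρ μ) :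
    ∃ (z : ℕ → X) (c t : ℝ), 0 < c ∧ (∃ᶠ n in Filter.atTop, c ≤ ‖z n‖) ∧
      ∀ N, ∫ ω, ‖signSum 𝕜 z (Finset.range N) (fun n => ρ n ω)‖ ^ 2 ∂μ ≤ t := by
  classical
  set Y : ℕ → Ω → X := fun n ω => signSum 𝕜 x (F n) (fun i => r i ω) with hY
  have hYm : ∀ n, StronglyMeasurable (Y n) := fun n =>
    stronglyMeasurable_signSum.comp_measurable hr.measurable_pi
  -- On the product space `ρ` is independent of the blocks, whatever its relation to `r` on Ω.
  set H : ℕ → Ω × Ω → ℝ := fun N p =>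
    ‖signSum 𝕜 (fun n => Y n p.1) (Finset.range N) (fun n => ρ n p.2)‖ ^ 2 with hH
  have hHm : ∀ N, StronglyMeasurable (H N) := fun N =>
    (Finset.stronglyMeasurable_fun_sum _ fun n _ =>
      ((RCLike.continuous_ofReal.measurable.comp
        ((hρ.measurable n).comp measurable_snd)).stronglyMeasurable.smul
        ((hYm n).comp_measurable measurable_fst))).norm.pow 2
  have hHi : ∀ N, Integrable (H N) (μ.prod μ) := by
    intro N
    refine Integrable.of_bound (hHm N).aestronglyMeasurable
      ((∑ n ∈ Finset.range N, ∑ i ∈ F n, ‖x i‖) ^ 2) (Filter.Eventually.of_forall fun p => ?_)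
    rw [Real.norm_eq_abs, abs_of_nonneg (by positivity)]
    refine pow_le_pow_left₀ (norm_nonneg _) ?_ 2
    exact (norm_signSum_le fun n => hρ.eq_or n p.2).trans
      (Finset.sum_le_sum fun n _ => norm_signSum_le fun i => hr.eq_or i p.1)
  set D : ℕ → Ω → ℝ := fun N ω => ∫ ω', H N (ω, ω') ∂μ with hD
  have hDi : ∀ N, Integrable (D N) μ := fun N => (hHi N).integral_prod_left
  have hDm : ∀ N, Measurable (D N) := fun N =>
    (hHm N).integral_prod_right.measurable
  have hD0 : ∀ N ω, 0 ≤ D N ω := fun N ω => integral_nonneg fun _ => sq_nonneg _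
  have hDK : ∀ N, ∫ ω, D N ω ∂μ ≤ K := by
    intro N
    rw [hD, integral_integral_swap (f := fun ω ω' => H N (ω, ω')) (hHi N)]
    have : ∀ ω', ∫ ω, H N (ω, ω') ∂μ ≤ K := by
      intro ω'
      have huniq : ∀ {k m n}, k ∈ F m → k ∈ F n → m = n := fun hm hn => by
        by_contra hmn
        exact Finset.disjoint_left.1 (hd hmn) hm hn
      -- For fixed ω', the block signs define a flip of the individual signs, since the blocks are
      -- disjoint; the value 1 off the blocks is immaterial.
      let s : ι → ℝ := fun k => if h : ∃ n, k ∈ F n then ρ h.choose ω' else 1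
      have hs : ∀ k, s k = 1 ∨ s k = -1 := by
        intro k
        by_cases h : ∃ n, k ∈ F n
        · simp only [s, dif_pos h]; exact hρ.eq_or _ _
        · simp [s, dif_neg h]
      have hsF : ∀ n, ∀ k ∈ F n, s k = ρ n ω' := by
        intro n k hk
        have h : ∃ n, k ∈ F n := ⟨n, hk⟩
        simp only [s, dif_pos h]
        rw [huniq h.choose_spec hk]
      have e : ∀ ω, H N (ω, ω') =
          ‖signSum 𝕜 x ((Finset.range N).biUnion F) (fun k => s k * r k ω)‖ ^ 2 := by
        intro ω
        simp only [hH, hY, signSum]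
        rw [Finset.sum_biUnion fun m _ n _ hmn => hd hmn]
        congr 2
        refine Finset.sum_congr rfl fun n _ => ?_
        rw [Finset.smul_sum]
        refine Finset.sum_congr rfl fun k hk => ?_
        rw [hsF n k hk, RCLike.ofReal_mul, mul_smul]
      simp only [e]
      exact (hr.integral_flip hs ((stronglyMeasurable_signSum (𝕜 := 𝕜)
        (x := x)).norm.measurable.pow_const 2)).trans_le (hK _)
    refine (integral_mono (hHi N).integral_prod_right (integrable_const K) this).trans ?_
    simp
  have hK0 : 0 ≤ K := (integral_nonneg fun _ => sq_nonneg _).trans (hK ∅)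
  -- `l` and `t` are chosen so that the second moment of a block and the mean of `D n` each
  -- contribute at most δ/8 below; K + 1 keeps both positive.
  set l := 8 * (K + 1) / δ with hl
  have hl0 : 0 < l := by positivity
  set t := 8 * l * (K + 1) / δ with ht
  have ht0 : 0 < t := by positivity
  set E : ℕ → Set Ω := fun n => {ω | δ / 2 ≤ ‖Y n ω‖ ∧ D n ω ≤ t} with hE
  have hEm : ∀ n, MeasurableSet (E n) := fun n =>
    (measurableSet_le measurable_const (hYm n).norm.measurable).inter
      (measurableSet_le (hDm n) measurable_const)
  have hEp : ∀ n, δ / (4 * l) ≤ μ.real (E n) := by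
    intro n
    -- On `E n` the terms in `l` and `l⁻¹` dominate; off it, either ‖Y‖ < δ/2 or D > t, which makes
    -- l/t · D exceed `l`, again enough. Integration gives δ ≤ δ/2 + l μ(E n) + δ/4.
    have hpt : ∀ ω, ‖Y n ω‖ ≤ δ / 2 + (E n).indicator (fun _ => l) ω + l / t * D n ω +
        l⁻¹ * ‖Y n ω‖ ^ 2 := by
      intro ω
      have hind : 0 ≤ (E n).indicator (fun _ => l) ω := Set.indicator_nonneg (fun _ _ => hl0.le) ω
      have h1 : 0 ≤ l / t * D n ω := mul_nonneg (by positivity) (hD0 n ω)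
      have h2 : 0 ≤ l⁻¹ * ‖Y n ω‖ ^ 2 := by positivity
      have h3 : ‖Y n ω‖ ≤ l + l⁻¹ * ‖Y n ω‖ ^ 2 := by
        have h4 : l * (l + l⁻¹ * ‖Y n ω‖ ^ 2 - ‖Y n ω‖) =
            (l - ‖Y n ω‖ / 2) ^ 2 + 3 / 4 * ‖Y n ω‖ ^ 2 := by field_simp; ring
        have h5 : 0 ≤ l * (l + l⁻¹ * ‖Y n ω‖ ^ 2 - ‖Y n ω‖) := by rw [h4]; positivity
        linarith [nonneg_of_mul_nonneg_right h5 hl0]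
      by_cases hY1 : δ / 2 ≤ ‖Y n ω‖
      · by_cases hD1 : D n ω ≤ t
        · rw [Set.indicator_of_mem (show ω ∈ E n from ⟨hY1, hD1⟩)]
          linarith
        · have : l ≤ l / t * D n ω := by
            rw [div_mul_eq_mul_div, le_div_iff₀ ht0]
            exact mul_le_mul_of_nonneg_left (not_le.1 hD1).le hl0.le
          linarith
      · linarith
    have hi1 : Integrable (fun ω => δ / 2 + (E n).indicator (fun _ => l) ω) μ :=
      (integrable_const _).add ((integrable_const l).indicator (hEm n))
    have hi2 : Integrable (fun ω => δ / 2 + (E n).indicator (fun _ => l) ω + l / t * D n ω) μ :=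
      hi1.add ((hDi n).const_mul _)
    have hi3 : Integrable (fun ω => l⁻¹ * ‖Y n ω‖ ^ 2) μ :=
      (hr.integrable_norm_signSum_sq x (F n)).const_mul _
    have h1 := (hF n).trans (integral_mono (hr.integrable_norm_signSum x (F n)) (hi2.add hi3) hpt)
    simp only [Pi.add_apply] at h1
    rw [integral_add hi2 hi3, integral_add hi1 ((hDi n).const_mul _),
      integral_add (integrable_const _) ((integrable_const l).indicator (hEm n)),
      integral_indicator_const _ (hEm n), integral_const_mul, integral_const_mul,
      integral_const, probReal_univ, one_smul, smul_eq_mul] at h1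
    have h2 : l / t * ∫ ω, D n ω ∂μ ≤ δ / 8 := by
      calc _ ≤ l / t * (K + 1) := by
            gcongr
            linarith [hDK n]
        _ = δ / 8 := by rw [ht]; field_simp
    have h3 : l⁻¹ * ∫ ω, ‖Y n ω‖ ^ 2 ∂μ ≤ δ / 8 := by
      calc _ ≤ l⁻¹ * (K + 1) := by
            gcongr
            linarith [hK (F n)]
        _ = δ / 8 := by rw [hl]; field_simp
    rw [div_le_iff₀ (by positivity)]
    linarith
  obtain ⟨ω, hω⟩ := exists_frequently_mem_of_le_measureReal hEm (by positivity) hEp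
  refine ⟨fun n => Y n ω, δ / 2, t, by positivity, hω.mono fun n hn => hn.1, fun N => ?_⟩
  -- The energy bound is known only for infinitely many `n`; contraction carries it down to every
  -- `N`.
  obtain ⟨n, hNn, hn⟩ := Filter.frequently_atTop.1 hω N
  exact (hρ.integral_norm_signSum_sq_mono (fun n => Y n ω)
    (Finset.range_subset_range.2 hNn)).trans hn.2

end IsSignFamily

/-! ### Riesz products and Kwapień's subsequence -/

/-- The Riesz product `∏ i ∈ J, (1 + s i * v i)`. -/
def rieszProd {ι : Type*} (J : Finset ι) (s v : ι → ℝ) : ℝ :=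
  ∏ i ∈ J, (1 + s i * v i)

theorem rieszProd_congr {ι : Type*} {J : Finset ι} {s s' v v' : ι → ℝ}
    (hs : ∀ i ∈ J, s i = s' i) (hv : ∀ i ∈ J, v i = v' i) : rieszProd J s v = rieszProd J s' v' :=
  Finset.prod_congr rfl fun i hi => by rw [hs i hi, hv i hi]

theorem rieszProd_insert {ι : Type*} [DecidableEq ι] {J : Finset ι} {n : ι} (hn : n ∉ J)
    (s v : ι → ℝ) : rieszProd (insert n J) s v = rieszProd J s v + s n * (rieszProd J s v * v n) := by
  rw [rieszProd, Finset.prod_insert hn, rieszProd]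
  ring

theorem measurable_rieszProd {ι : Type*} (J : Finset ι) (s : ι → ℝ) :
    Measurable (rieszProd J s) :=
  Finset.measurable_prod _ fun i _ => ((measurable_pi_apply i).const_mul _).const_add _

theorem rieszProd_nonneg {ι : Type*} {J : Finset ι} {s v : ι → ℝ} (hs : ∀ i, s i = 1 ∨ s i = -1)
    (hv : ∀ i, v i = 1 ∨ v i = -1) : 0 ≤ rieszProd J s v :=
  Finset.prod_nonneg fun i _ => by
    rcases hs i with h | h <;> rcases hv i with h' | h' <;> norm_num [h, h']

theorem rieszProd_le {ι : Type*} {J : Finset ι} {s v : ι → ℝ} (hs : ∀ i, s i = 1 ∨ s i = -1)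
    (hv : ∀ i, v i = 1 ∨ v i = -1) : rieszProd J s v ≤ 2 ^ J.card := by
  rw [← Finset.prod_const]
  refine Finset.prod_le_prod ?_ ?_ <;> intro i _ <;>
    rcases hs i with h | h <;> rcases hv i with h' | h' <;> norm_num [h, h']

namespace IsSignFamily

variable {ι Ω : Type*} [MeasurableSpace Ω] {r : ι → Ω → ℝ} {μ : Measure Ω} [IsProbabilityMeasure μ]
  {𝕜 : Type*} [RCLike 𝕜] {X : Type*} [NormedAddCommGroup X] [NormedSpace 𝕜 X]

theorem integrable_mul_rieszProd (hr : IsSignFamily r μ) {f : (ι → ℝ) → ℝ} (hf : Measurable f)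
    (hf1 : ∀ v, |f v| ≤ 1) (J : Finset ι) {s : ι → ℝ} (hs : ∀ i, s i = 1 ∨ s i = -1) :
    Integrable (fun ω => f (fun i => r i ω) * rieszProd J s (fun i => r i ω)) μ :=
  hr.integrable_of_le (hf.mul (measurable_rieszProd J s)) (C := 2 ^ J.card) fun v hv => by
    rw [Pi.mul_apply, abs_mul, abs_of_nonneg (rieszProd_nonneg hs hv)]
    exact (mul_le_of_le_one_left (rieszProd_nonneg hs hv) (hf1 v)).trans (rieszProd_le hs hv)

/-- Each new factor adds a term that is odd under flipping its own sign. The Riesz product is thus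
the density of the conditional probability given that the signs on `J` agree with `s`. -/
theorem integral_rieszProd (hr : IsSignFamily r μ) (J : Finset ι) {s : ι → ℝ}
    (hs : ∀ i, s i = 1 ∨ s i = -1) : ∫ ω, rieszProd J s (fun i => r i ω) ∂μ = 1 := by
  classical
  induction J using Finset.induction_on with
  | empty => simp [rieszProd]
  | insert n J hn ih =>
    have h1 : Integrable (fun ω => rieszProd J s (fun i => r i ω)) μ := by
      simpa using hr.integrable_mul_rieszProd (f := fun _ => 1) measurable_const (by simp) J hs
    have h2 : Integrable (fun ω => rieszProd J s (fun i => r i ω) * r n ω) μ :=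
      hr.integrable_of_le (g := fun v => rieszProd J s v * v n) (C := 2 ^ J.card)
        ((measurable_rieszProd J s).mul (measurable_pi_apply n)) fun v hv => by
        have : |v n| = 1 := by rcases hv n with h | h <;> simp [h]
        rw [abs_mul, this, mul_one, abs_of_nonneg (rieszProd_nonneg hs hv)]
        exact rieszProd_le hs hv
    have h3 : ∫ ω, rieszProd J s (fun i => r i ω) * r n ω ∂μ = 0 := by
      have h := hr.integral_flip (s := fun k => if k = n then -1 else 1)
        (fun k => by by_cases h : k = n <;> simp [h]) (g := fun v => rieszProd J s v * v n)
        ((measurable_rieszProd J s).mul (measurable_pi_apply n))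
      have e : ∀ ω, rieszProd J s (fun k => (if k = n then -1 else 1) * r k ω) =
          rieszProd J s (fun k => r k ω) := fun ω =>
        rieszProd_congr (fun _ _ => rfl) fun i hi => by
          rw [if_neg (ne_of_mem_of_not_mem hi hn), one_mul]
      simp only [e, if_true, neg_mul, one_mul, mul_neg, integral_neg] at h
      linarith
    simp only [rieszProd_insert hn]
    rw [integral_add h1 (h2.const_mul _), integral_const_mul, h3, ih, mul_zero, add_zero]

/-- Along an ultrafilter, the correlations of uniformly bounded functions with all but finitely
many signs are small. -/
theorem eventually_abs_integral_mul_le (hr : IsSignFamily r μ) {g : ℕ → Ω → ℝ}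
    (hg : ∀ N, Measurable (g N)) {C : ℝ} (hC : ∀ N ω, |g N ω| ≤ C) (U : Ultrafilter ℕ) {η : ℝ}
    (hη : 0 < η) :
    ∀ᶠ n in Filter.cofinite, ∀ᶠ N in (U : Filter ℕ), |∫ ω, g N ω * r n ω ∂μ| ≤ η := by
  rw [Filter.eventually_cofinite]
  by_contra hinf
  -- With more than C²/η² exceptional signs, the ultrafilter supplies a single `N` at which all
  -- these correlations exceed `η`, against Bessel.
  obtain ⟨m, hm⟩ := exists_nat_gt (C ^ 2 / η ^ 2)
  obtain ⟨F, hF, hFm⟩ := Set.Infinite.exists_subset_card_eq hinf m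
  have h1 : ∀ᶠ N in (U : Filter ℕ), ∀ n ∈ F, η < |∫ ω, g N ω * r n ω ∂μ| := by
    rw [Filter.eventually_all_finset]
    intro n hn
    have := hF hn
    rw [Set.mem_ofPred_eq, ← Ultrafilter.eventually_not] at this
    simpa using this
  obtain ⟨N, hN⟩ := h1.exists
  have h2 := hr.sum_integral_mul_sq_le (hg N) (hC N) F
  have h3 : ∑ _n ∈ F, η ^ 2 ≤ ∑ n ∈ F, (∫ ω, g N ω * r n ω ∂μ) ^ 2 :=
    Finset.sum_le_sum fun n hn => by
      rw [← sq_abs (∫ ω, g N ω * r n ω ∂μ)]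
      exact pow_le_pow_left₀ hη.le (hN n hn).le 2
  rw [Finset.sum_const, hFm, nsmul_eq_mul] at h3
  rw [div_lt_iff₀ (by positivity)] at hm
  linarith

/-- `J` is generic for the bounded functions `f N` if, along the ultrafilter `U`, the functions
`f N` have mean larger than `1/2` on each of the events prescribing the signs indexed by `J`. -/
def Generic (r : ι → Ω → ℝ) (μ : Measure Ω) (f : ℕ → (ι → ℝ) → ℝ) (U : Ultrafilter ℕ)
    (J : Finset ι) : Prop :=
  ∃ θ : ℝ, 1 / 2 < θ ∧ ∀ s : ι → ℝ, (∀ i, s i = 1 ∨ s i = -1) → ∀ᶠ N in (U : Filter ℕ),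
    θ ≤ ∫ ω, f N (fun i => r i ω) * rieszProd J s (fun i => r i ω) ∂μ

/-- Prescribing one more sign changes each conditional mean by plus or minus a correlation with that
sign. For all but finitely many signs this costs at most half of the excess over 1/2. -/
theorem exists_generic_insert [DecidableEq ι] [Infinite ι] (hr : IsSignFamily r μ)
    {f : ℕ → (ι → ℝ) → ℝ} (hf : ∀ N, Measurable (f N)) (hf1 : ∀ N v, |f N v| ≤ 1)
    {U : Ultrafilter ℕ} {J : Finset ι} (hJ : Generic r μ f U J) :
    ∃ n ∉ J, Generic r μ f U (insert n J) := by
  obtain ⟨θ, hθ, hJ⟩ := hJ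
  have hgm : ∀ (s : ι → ℝ) N, Measurable fun ω =>
      f N (fun i => r i ω) * rieszProd J s (fun i => r i ω) :=
    fun s N => ((hf N).mul (measurable_rieszProd J s)).comp hr.measurable_pi
  have hgb : ∀ (s : ι → ℝ), (∀ i, s i = 1 ∨ s i = -1) → ∀ N ω,
      |f N (fun i => r i ω) * rieszProd J s (fun i => r i ω)| ≤ 2 ^ J.card := fun s hs N ω => by
    have hv := fun i => hr.eq_or i ω
    rw [abs_mul, abs_of_nonneg (rieszProd_nonneg hs hv)]
    exact (mul_le_of_le_one_left (rieszProd_nonneg hs hv) (hf1 N _)).trans (rieszProd_le hs hv)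
  -- Only the restriction of `s` to `J` matters, so the finitely many patterns coded by subsets of
  -- `J` suffice.
  set sg : Finset ι → ι → ℝ := fun T i => if i ∈ T then 1 else -1 with hsg
  have hsg1 : ∀ T i, sg T i = 1 ∨ sg T i = -1 := fun T i => by
    by_cases h : i ∈ T <;> simp [hsg, h]
  have hev : ∀ᶠ n in Filter.cofinite, ∀ T ∈ J.powerset, ∀ᶠ N in (U : Filter ℕ),
      |∫ ω, f N (fun i => r i ω) * rieszProd J (sg T) (fun i => r i ω) * r n ω ∂μ| ≤
        (θ - 1 / 2) / 2 := by
    rw [Filter.eventually_all_finset]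
    exact fun T _ => hr.eventually_abs_integral_mul_le (hgm _) (hgb _ (hsg1 T)) U (by linarith)
  obtain ⟨n, hn, hnJ⟩ := (hev.and J.eventually_cofinite_notMem).exists
  refine ⟨n, hnJ, θ - (θ - 1 / 2) / 2, by linarith, fun s hs => ?_⟩
  have hT := hn (J.filter fun i => s i = 1) (by simp)
  have e : ∀ ω, rieszProd J (sg (J.filter fun i => s i = 1)) (fun i => r i ω) =
      rieszProd J s (fun i => r i ω) := fun ω => by
    refine rieszProd_congr (fun i hi => ?_) fun _ _ => rfl
    rcases hs i with h | h <;> norm_num [hsg, hi, h]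
  simp only [e] at hT
  filter_upwards [hT, hJ s hs] with N h1 h2
  have hi := hr.integrable_mul_rieszProd (hf N) (hf1 N) J hs
  have hi' : Integrable (fun ω => f N (fun i => r i ω) * rieszProd J s (fun i => r i ω) * r n ω) μ :=
    Integrable.of_bound ((hgm s N).mul (hr.measurable n)).aestronglyMeasurable (2 ^ J.card)
      (Filter.Eventually.of_forall fun ω => by
        have : |r n ω| = 1 := by rcases hr.eq_or n ω with h | h <;> simp [h]
        rw [Real.norm_eq_abs, abs_mul, this, mul_one]
        exact hgb s hs N ω)
  have e2 : ∀ ω, f N (fun i => r i ω) * rieszProd (insert n J) s (fun i => r i ω) =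
      f N (fun i => r i ω) * rieszProd J s (fun i => r i ω) +
        s n * (f N (fun i => r i ω) * rieszProd J s (fun i => r i ω) * r n ω) := fun ω => by
    rw [rieszProd_insert hnJ]; ring
  simp only [e2]
  rw [integral_add hi (hi'.const_mul _), integral_const_mul]
  have h3 := abs_le.1 h1
  rcases hs n with h | h <;> rw [h] <;> linarith

theorem exists_injective_generic [DecidableEq ι] [Infinite ι] (hr : IsSignFamily r μ)
    {f : ℕ → (ι → ℝ) → ℝ} (hf : ∀ N, Measurable (f N)) (hf1 : ∀ N v, |f N v| ≤ 1)
    {U : Ultrafilter ℕ} (h0 : Generic r μ f U ∅) :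
    ∃ u : ℕ → ι, Function.Injective u ∧ ∀ k, Generic r μ f U ((Finset.range k).image u) := by
  choose n hn hn' using fun J : {J // Generic r μ f U J} => hr.exists_generic_insert hf hf1 J.2
  let J : ℕ → {J // Generic r μ f U J} := fun k => Nat.rec ⟨∅, h0⟩ (fun _ J => ⟨_, hn' J⟩) k
  have hJs : ∀ k, (J (k + 1)).1 = insert (n (J k)) (J k).1 := fun k => rfl
  have hJ : ∀ k, (J k).1 = (Finset.range k).image fun i => n (J i) := by
    intro k
    induction k with
    | zero => rfl
    | succ k ih => rw [hJs, Finset.range_add_one, Finset.image_insert, ← ih]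
  refine ⟨fun k => n (J k), Function.Injective.of_lt_imp_ne fun a b hab heq => hn (J b) ?_,
    fun k => hJ k ▸ (J k).2⟩
  rw [hJ b, ← heq]
  exact Finset.mem_image_of_mem _ (Finset.mem_range.2 hab)

/-- If `J` is generic for the events that the partial sums of a Rademacher series are bounded by
`C`, then all signed sums over `J` are bounded by `C`. -/
theorem norm_sum_le_of_generic {r : ℕ → Ω → ℝ} (hr : IsSignFamily r μ) {y : ℕ → X} {C : ℝ}
    {U : Ultrafilter ℕ} (hU : (U : Filter ℕ) ≤ Filter.atTop) {J : Finset ℕ}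
    (hJ : Generic r μ (fun N =>
      Set.indicator {v | ‖signSum 𝕜 y (Finset.range N) v‖ ≤ C} fun _ => 1) U J)
    {s : ℕ → ℝ} (hs : ∀ i, s i = 1 ∨ s i = -1) : ‖signSum 𝕜 y J s‖ ≤ C := by
  classical
  obtain ⟨θ, hθ, hJ⟩ := hJ
  obtain ⟨N, hN, hJN⟩ := ((hJ s hs).and
    (hU (Filter.eventually_ge_atTop (J.sup id + 1)))).exists
  have hJN' : J ⊆ Finset.range N := fun i hi => by
    have := Finset.le_sup (f := id) hi
    simp only [id] at this
    exact Finset.mem_range.2 (by omega)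
  set A : Set (ℕ → ℝ) := {v | ‖signSum 𝕜 y (Finset.range N) v‖ ≤ C} with hA
  have hAm : MeasurableSet A :=
    measurableSet_le stronglyMeasurable_signSum.norm.measurable measurable_const
  have hfm : Measurable (A.indicator fun _ => (1 : ℝ)) := measurable_const.indicator hAm
  have hf1 : ∀ v, |A.indicator (fun _ => (1 : ℝ)) v| ≤ 1 := fun v => by
    by_cases h : v ∈ A <;> simp [h]
  -- The flip off `J` leaves the conditional measure given the signs on `J` unchanged.
  set σ : ℕ → ℝ := fun i => if i ∈ J then 1 else -1 with hσ
  have hσ1 : ∀ i, σ i = 1 ∨ σ i = -1 := fun i => by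
    by_cases h : i ∈ J <;> simp [hσ, h]
  have hfl := hr.integral_flip hσ1 (hfm.mul (measurable_rieszProd J s))
  have e : ∀ ω, rieszProd J s (fun i => σ i * r i ω) = rieszProd J s (fun i => r i ω) := fun ω =>
    rieszProd_congr (fun _ _ => rfl) fun i hi => by simp [hσ, hi]
  have hi1 := hr.integrable_mul_rieszProd hfm hf1 J hs
  have hi2 := (hr.flip hσ1).integrable_mul_rieszProd hfm hf1 J hs
  have hi3 : Integrable (fun ω => rieszProd J s (fun i => r i ω)) μ := by
    simpa using hr.integrable_mul_rieszProd (f := fun _ => 1) measurable_const (by simp) J hs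
  simp only [Pi.mul_apply, e] at hfl hi2
  have hi4 : Integrable (fun ω => A.indicator (fun _ => (1 : ℝ)) (fun i => r i ω) *
      rieszProd J s (fun i => r i ω) + A.indicator (fun _ => (1 : ℝ)) (fun i => σ i * r i ω) *
      rieszProd J s (fun i => r i ω)) μ := hi1.add hi2
  -- Conditionally, `A` and its flip both have probability at least θ > 1/2, so they meet: the
  -- integral is at least 2θ - 1.
  have hpos : 0 < ∫ ω, (A.indicator (fun _ => (1 : ℝ)) (fun i => r i ω) *
      rieszProd J s (fun i => r i ω) + A.indicator (fun _ => (1 : ℝ)) (fun i => σ i * r i ω) *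
      rieszProd J s (fun i => r i ω) - rieszProd J s (fun i => r i ω)) ∂μ := by
    rw [integral_sub hi4 hi3, integral_add hi1 hi2, hfl, hr.integral_rieszProd J hs]
    linarith
  obtain ⟨ω, hω⟩ : ∃ ω, 0 < A.indicator (fun _ => (1 : ℝ)) (fun i => r i ω) *
      rieszProd J s (fun i => r i ω) + A.indicator (fun _ => (1 : ℝ)) (fun i => σ i * r i ω) *
      rieszProd J s (fun i => r i ω) - rieszProd J s (fun i => r i ω) := by
    by_contra! h
    exact absurd (integral_nonpos h) (not_le.2 hpos)
  have hR0 : 0 ≤ rieszProd J s (fun i => r i ω) := rieszProd_nonneg hs fun i => hr.eq_or i ω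
  have h1 : (fun i => r i ω) ∈ A := by
    by_contra h
    rw [Set.indicator_of_notMem h] at hω
    nlinarith [(abs_le.1 (hf1 fun i => σ i * r i ω)).2]
  have h2 : (fun i => σ i * r i ω) ∈ A := by
    by_contra h
    rw [Set.indicator_of_notMem h] at hω
    nlinarith [(abs_le.1 (hf1 fun i => r i ω)).2]
  rw [Set.indicator_of_mem h1, Set.indicator_of_mem h2] at hω
  -- A nonzero Riesz product forces the signs on `J` to be those of `s`.
  have hR : rieszProd J s (fun i => r i ω) ≠ 0 := fun h => by simp [h] at hω
  have hrs : ∀ i ∈ J, s i = r i ω := by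
    intro i hi
    have := Finset.prod_ne_zero_iff.1 hR i hi
    rcases hs i with h | h <;> rcases hr.eq_or i ω with h' | h' <;> simp_all
  rw [signSum_congr hrs]
  have h3 := norm_signSum_le_flip (𝕜 := 𝕜) (x := y) hJN' (fun i => r i ω) σ
    (fun i hi => by simp [hσ, hi]) (fun i _ hi => by simp [hσ, hi])
  simp only [hA, Set.mem_ofPred_eq] at h1 h2
  linarith

/-- Kwapień: a Rademacher series with bounded partial sums has a subseries all of whose signed
sums are uniformly bounded. -/
theorem exists_injective_bounded_sign_sums {r : ℕ → Ω → ℝ} (hr : IsSignFamily r μ) {y : ℕ → X}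
    {t : ℝ} (ht : ∀ N, ∫ ω, ‖signSum 𝕜 y (Finset.range N) (fun n => r n ω)‖ ^ 2 ∂μ ≤ t) :
    ∃ (u : ℕ → ℕ) (C : ℝ), ∀ n (s : ℕ → ℝ), (∀ i, s i = 1 ∨ s i = -1) →
      ‖∑ i ∈ Finset.range n, (s i : 𝕜) • y (u i)‖ ≤ C := by
  have ht0 : 0 ≤ t := (integral_nonneg fun _ => sq_nonneg _).trans (ht 0)
  -- By Chebyshev an exceptional event has probability at most t/C² ≤ 1/4.
  set C := 2 * (t + 1) with hC
  have hC0 : 0 < C := by positivity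
  set A : ℕ → Set (ℕ → ℝ) := fun N => {v | ‖signSum 𝕜 y (Finset.range N) v‖ ≤ C} with hA
  have hAm : ∀ N, MeasurableSet (A N) := fun N =>
    measurableSet_le stronglyMeasurable_signSum.norm.measurable measurable_const
  have hfm : ∀ N, Measurable ((A N).indicator fun _ => (1 : ℝ)) := fun N =>
    measurable_const.indicator (hAm N)
  have hf1 : ∀ N v, |(A N).indicator (fun _ => (1 : ℝ)) v| ≤ 1 := fun N v => by
    by_cases h : v ∈ A N <;> simp [h]
  have h0 : Generic r μ (fun N => (A N).indicator fun _ => (1 : ℝ)) (Filter.hyperfilter ℕ) ∅ := by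
    refine ⟨3 / 4, by norm_num, fun s _ => Filter.Eventually.of_forall fun N => ?_⟩
    simp only [rieszProd, Finset.prod_empty, mul_one]
    have hi := hr.integrable_of_le (hfm N) fun v _ => hf1 N v
    have h1 : ∫ ω, (1 - (C ^ 2)⁻¹ * ‖signSum 𝕜 y (Finset.range N) (fun n => r n ω)‖ ^ 2) ∂μ ≤
        ∫ ω, (A N).indicator (fun _ => (1 : ℝ)) (fun n => r n ω) ∂μ := by
      refine integral_mono ((integrable_const 1).sub
        ((hr.integrable_norm_signSum_sq y _).const_mul _)) hi fun ω => ?_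
      by_cases h : (fun n => r n ω) ∈ A N
      · simp only [Set.indicator_of_mem h]
        have : 0 ≤ (C ^ 2)⁻¹ * ‖signSum 𝕜 y (Finset.range N) (fun n => r n ω)‖ ^ 2 := by positivity
        linarith
      · simp only [Set.indicator_of_notMem h]
        have h2 : C < ‖signSum 𝕜 y (Finset.range N) (fun n => r n ω)‖ := not_le.1 h
        have : 1 ≤ (C ^ 2)⁻¹ * ‖signSum 𝕜 y (Finset.range N) (fun n => r n ω)‖ ^ 2 := by
          rw [inv_mul_eq_div, le_div_iff₀ (by positivity), one_mul]
          exact pow_le_pow_left₀ hC0.le h2.le 2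
        linarith
    rw [integral_sub (integrable_const 1) ((hr.integrable_norm_signSum_sq y _).const_mul _),
      integral_const_mul, integral_const, probReal_univ, one_smul] at h1
    have h2 : (C ^ 2)⁻¹ * ∫ ω, ‖signSum 𝕜 y (Finset.range N) (fun n => r n ω)‖ ^ 2 ∂μ ≤ 1 / 4 := by
      calc _ ≤ (C ^ 2)⁻¹ * t := by gcongr; exact ht N
        _ ≤ 1 / 4 := by
          rw [inv_mul_eq_div, div_le_div_iff₀ (by positivity) (by norm_num), hC]
          nlinarith
    linarith
  obtain ⟨u, hu, hug⟩ := hr.exists_injective_generic hfm hf1 h0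
  refine ⟨u, C, fun n s hs => ?_⟩
  have := hr.norm_sum_le_of_generic Nat.hyperfilter_le_atTop (hug n)
    (s := fun j => s (Function.invFun u j)) fun i => hs _
  rw [signSum, Finset.sum_image fun a _ b _ h => hu h] at this
  simpa only [Function.leftInverse_invFun hu _] using this

end IsSignFamily

/-! ### Rosenthal's lemma and the Bessaga–Pełczyński theorem -/

/-- A weak form of Rosenthal's lemma: if the rows of the matrix `m` are bounded, then the
off-diagonal part of a suitable infinite principal submatrix has rows bounded by `δ`. -/
theorem exists_injective_sum_submatrix_le {δ : ℝ} (hδ : 0 ≤ δ) (n : ℕ) : ∀ (m : ℕ → ℕ → ℝ),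
    (∀ j (F : Finset ℕ), j ∉ F → ∑ i ∈ F, m j i ≤ n * δ) →
    ∃ v : ℕ → ℕ, Function.Injective v ∧
      ∀ j (F : Finset ℕ), j ∉ F → ∑ i ∈ F, m (v j) (v i) ≤ δ := by
  induction n with
  | zero =>
    intro m h
    refine ⟨id, Function.injective_id, fun j F hj => ?_⟩
    have := h j F hj
    rw [Nat.cast_zero, zero_mul] at this
    exact this.trans hδ
  | succ n ih =>
    intro m h
    -- Pairing splits ℕ into infinitely many infinite classes; either one class already works, or
    -- each contains a row with off-diagonal mass above `δ` inside its own class.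
    by_cases hp : ∃ p, ∀ k (F : Finset ℕ), k ∉ F →
        ∑ i ∈ F, m (Nat.pair p k) (Nat.pair p i) ≤ δ
    · obtain ⟨p, hp⟩ := hp
      exact ⟨fun k => Nat.pair p k, fun a b hab => (Nat.pair_eq_pair.1 hab).2, hp⟩
    · push Not at hp
      choose k F hk hF using hp
      have hinj : Function.Injective fun p => Nat.pair p (k p) :=
        fun a b hab => (Nat.pair_eq_pair.1 hab).1
      -- Keep one such bad row index per class. The mass above `δ` sits on discarded indices, so the
      -- bound for the remaining rows drops from (n + 1)δ to nδ.
      obtain ⟨v, hv, hv'⟩ := ih (fun p q => m (Nat.pair p (k p)) (Nat.pair q (k q))) (by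
        intro p G hp
        have hpi : Function.Injective (Nat.pair p) := fun a b hab => (Nat.pair_eq_pair.1 hab).2
        have hd : Disjoint (G.map ⟨_, hinj⟩)
            ((F p).map ⟨Nat.pair p, hpi⟩) := by
          rw [Finset.disjoint_left]
          simp only [Finset.mem_map, Function.Embedding.coeFn_mk]
          rintro _ ⟨q, hq, rfl⟩ ⟨i, hi, hqi⟩
          rw [Nat.pair_eq_pair] at hqi
          exact hp (hqi.1 ▸ hq)
        have hsum := h (Nat.pair p (k p)) ((G.map ⟨_, hinj⟩).disjUnion _ hd) (by
          simp only [Finset.mem_disjUnion, Finset.mem_map, Function.Embedding.coeFn_mk]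
          rintro (⟨q, hq, hqp⟩ | ⟨i, hi, hip⟩)
          · exact hp ((Nat.pair_eq_pair.1 hqp).1 ▸ hq)
          · exact hk p ((Nat.pair_eq_pair.1 hip).2 ▸ hi))
        rw [Finset.sum_disjUnion, Finset.sum_map, Finset.sum_map] at hsum
        have h2 := hF p
        simp only [Function.Embedding.coeFn_mk] at hsum
        push_cast at hsum
        linarith)
      exact ⟨fun p => Nat.pair (v p) (k (v p)), hinj.comp hv, hv'⟩

section BessagaPelczynski

variable {𝕜 : Type*} [RCLike 𝕜] {X : Type*} [NormedAddCommGroup X] [NormedSpace 𝕜 X]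

/-- Bounded signed sums make the series `∑ y i` weakly unconditionally Cauchy, uniformly on the
dual unit ball. -/
theorem sum_norm_dual_le {C : ℝ} {y : ℕ → X}
    (hC : ∀ n (s : ℕ → ℝ), (∀ i, s i = 1 ∨ s i = -1) →
      ‖∑ i ∈ Finset.range n, (s i : 𝕜) • y i‖ ≤ C)
    (f : StrongDual 𝕜 X) (hf : ‖f‖ ≤ 1) (F : Finset ℕ) :
    ∑ i ∈ F, ‖f (y i)‖ ≤ 2 * C := by
  obtain ⟨n, hn⟩ : ∃ n, F ⊆ Finset.range n := ⟨F.sup id + 1, fun i hi => by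
    have := Finset.le_sup (f := id) hi
    simp at this ⊢; omega⟩
  refine (Finset.sum_le_sum_of_subset_of_nonneg hn fun _ _ _ => norm_nonneg _).trans ?_
  -- Only real signs are available, so real and imaginary parts are handled separately; this costs
  -- the factor 2.
  have key : ∀ (g : 𝕜 →ₗ[ℝ] ℝ), (∀ z, |g z| ≤ ‖z‖) →
      ∑ i ∈ Finset.range n, |g (f (y i))| ≤ C := by
    intro g hg
    have h1 := hC n (fun i => if 0 ≤ g (f (y i)) then 1 else -1) (fun i => by
      by_cases h : 0 ≤ g (f (y i)) <;> simp [h])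
    refine le_trans ?_ ((f.le_of_opNorm_le hf _).trans (by rwa [one_mul]))
    refine le_trans ?_ ((le_abs_self _).trans (hg _))
    rw [map_sum, map_sum]
    refine Finset.sum_le_sum fun i _ => ?_
    rw [map_smul, smul_eq_mul, ← RCLike.real_smul_eq_coe_mul, map_smul, smul_eq_mul]
    split_ifs with h
    · rw [abs_of_nonneg h, one_mul]
    · rw [abs_of_neg (not_le.1 h)]; simp
  have h1 := key RCLike.reLm RCLike.abs_re_le_norm
  have h2 := key RCLike.imLm RCLike.abs_im_le_norm
  calc ∑ i ∈ Finset.range n, ‖f (y i)‖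
      ≤ ∑ i ∈ Finset.range n, (|RCLike.reLm (f (y i))| + |RCLike.imLm (f (y i))|) :=
        Finset.sum_le_sum fun i _ => by
          conv_lhs => rw [← RCLike.re_add_im (f (y i))]
          refine (norm_add_le _ _).trans (add_le_add (RCLike.norm_ofReal _).le ?_)
          rw [norm_mul, RCLike.norm_ofReal]
          exact mul_le_of_le_one_right (abs_nonneg _) (by rw [RCLike.norm_I]; split_ifs <;> simp)
    _ ≤ 2 * C := by rw [Finset.sum_add_distrib]; linarith

/-- A norming functional of the sum reduces the estimate to scalars. -/
theorem norm_sum_smul_le_of_dual {C : ℝ} {y : ℕ → X}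
    (hC : ∀ (f : StrongDual 𝕜 X), ‖f‖ ≤ 1 → ∀ F : Finset ℕ, ∑ i ∈ F, ‖f (y i)‖ ≤ C)
    (F : Finset ℕ) (a : ℕ → 𝕜) {b : ℝ} (hb : 0 ≤ b) (ha : ∀ i ∈ F, ‖a i‖ ≤ b) :
    ‖∑ i ∈ F, a i • y i‖ ≤ b * C := by
  obtain ⟨f, hf, hfx⟩ := exists_dual_vector'' 𝕜 (∑ i ∈ F, a i • y i)
  have : ‖f (∑ i ∈ F, a i • y i)‖ = ‖∑ i ∈ F, a i • y i‖ := by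
    rw [hfx]; simp
  rw [← this, map_sum]
  calc ‖∑ i ∈ F, f (a i • y i)‖ ≤ ∑ i ∈ F, b * ‖f (y i)‖ := by
        refine (norm_sum_le _ _).trans (Finset.sum_le_sum fun i hi => ?_)
        rw [map_smul, norm_smul]
        exact mul_le_mul_of_nonneg_right (ha i hi) (norm_nonneg _)
    _ ≤ b * C := by
        rw [← Finset.mul_sum]
        exact mul_le_mul_of_nonneg_left (hC f hf F) hb

/-- Bessaga–Pełczyński: a sequence which is bounded below and has bounded signed sums spans a copy
of `c₀` along a subsequence. -/
theorem containsC0_of_bounded_sign_sums [CompleteSpace X] {c C : ℝ} (hc : 0 < c) {y : ℕ → X}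
    (hy : ∀ i, c ≤ ‖y i‖)
    (hC : ∀ n (s : ℕ → ℝ), (∀ i, s i = 1 ∨ s i = -1) →
      ‖∑ i ∈ Finset.range n, (s i : 𝕜) • y i‖ ≤ C) :
    ContainsC0 𝕜 X := by
  have hdual := fun (f : StrongDual 𝕜 X) (hf : ‖f‖ ≤ 1) => sum_norm_dual_le hC f hf
  -- After thinning, each norming functional sees its own vector with weight at least `c` and all
  -- the others with total weight at most c/2.
  choose f hf hfy using fun i => exists_dual_vector'' 𝕜 (y i)
  obtain ⟨n, hn⟩ := exists_nat_ge (2 * C / (c / 2))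
  obtain ⟨v, hv, hvs⟩ := exists_injective_sum_submatrix_le (δ := c / 2) (by positivity) n
    (fun j i => ‖f j (y i)‖) (fun j F _ => (hdual (f j) (hf j) F).trans ((div_le_iff₀ (by positivity)).1 hn))
  set z := y ∘ v
  set C' := 2 * C with hC'
  have hz : ∀ g : StrongDual 𝕜 X, ‖g‖ ≤ 1 → ∀ F : Finset ℕ, ∑ i ∈ F, ‖g (z i)‖ ≤ C' := by
    intro g hg F
    have := hdual g hg (F.map ⟨v, hv⟩)
    rwa [Finset.sum_map] at this
  have hC0 : 0 ≤ C' := by simpa using hz 0 (by simp) ∅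
  have hle := fun F (a : ℕ → 𝕜) b => norm_sum_smul_le_of_dual hz F a (b := b)
  have hsum : ∀ a : C₀(ℕ, 𝕜), Summable fun i => a i • z i := by
    intro a
    rw [summable_iff_vanishing_norm]
    intro ε hε
    have ha : ∀ᶠ i in Filter.cofinite, ‖a i‖ < ε / (C' + 1) := by
      have h := (zero_at_infty a).norm
      rw [cocompact_eq_atTop, norm_zero] at h
      rw [Nat.cofinite_eq_atTop]
      exact h.eventually (gt_mem_nhds (by positivity))
    rw [Filter.eventually_cofinite] at ha
    refine ⟨ha.toFinset, fun t ht => ?_⟩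
    refine (hle t a (ε / (C' + 1)) (by positivity) fun i hi => ?_).trans_lt ?_
    · by_contra hcon
      exact Finset.disjoint_left.1 ht hi (by
        simp only [Set.Finite.mem_toFinset, Set.mem_ofPred_eq, not_lt]
        exact (not_le.1 hcon).le)
    · rw [div_mul_eq_mul_div, div_lt_iff₀ (by positivity)]
      nlinarith
  have hnorm : ∀ (a : C₀(ℕ, 𝕜)) i, ‖a i‖ ≤ ‖a‖ := fun a i => a.toBCF.norm_coe_le_norm i
  let T : C₀(ℕ, 𝕜) →ₗ[𝕜] X :=
    { toFun := fun a => ∑' i, a i • z i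
      map_add' := fun a b => by
        rw [← (hsum a).tsum_add (hsum b)]
        simp [add_smul]
      map_smul' := fun k a => by
        rw [RingHom.id_apply, ← (hsum a).tsum_const_smul]
        simp [mul_smul] }
  let T' : C₀(ℕ, 𝕜) →L[𝕜] X := T.mkContinuous C' fun a => by
    refine le_of_tendsto (hsum a).hasSum.norm (Filter.Eventually.of_forall fun F => ?_)
    rw [mul_comm]
    exact hle F a ‖a‖ (norm_nonneg _) fun i _ => hnorm a i
  -- Testing against the `j`-th norming functional gives c‖a j‖ ≤ ‖T' a‖ + (c/2)‖a‖; the supremum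
  -- over `j` absorbs the last term.
  have hlow : ∀ a, c / 2 * ‖a‖ ≤ ‖T' a‖ := by
    intro a
    have h1 : ∀ j, c * ‖a j‖ ≤ ‖T' a‖ + ‖a‖ * (c / 2) := by
      intro j
      have h2 : HasSum (fun i => a i * f (v j) (z i)) (f (v j) (T' a)) := by
        have := (f (v j)).hasSum (hsum a).hasSum
        simp only [map_smul, smul_eq_mul] at this
        exact this
      have h3 : ‖f (v j) (T' a)‖ ≤ ‖T' a‖ := by
        simpa using (f (v j)).le_of_opNorm_le (hf _) (T' a)
      have h4 : c * ‖a j‖ - ‖a‖ * (c / 2) ≤ ‖f (v j) (T' a)‖ := by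
        refine ge_of_tendsto h2.norm ?_
        filter_upwards [Filter.eventually_ge_atTop {j}] with F hF
        have hj : j ∈ F := hF (Finset.mem_singleton_self j)
        rw [← Finset.add_sum_erase _ _ hj]
        have h5 : ‖a j * f (v j) (z j)‖ = ‖y (v j)‖ * ‖a j‖ := by
          simp [z, hfy, mul_comm]
        have h6 : ‖∑ i ∈ F.erase j, a i * f (v j) (z i)‖ ≤ ‖a‖ * (c / 2) := by
          calc _ ≤ ∑ i ∈ F.erase j, ‖a‖ * ‖f (v j) (z i)‖ := by
                refine (norm_sum_le _ _).trans (Finset.sum_le_sum fun i _ => ?_)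
                rw [norm_mul]
                exact mul_le_mul_of_nonneg_right (hnorm a i) (norm_nonneg _)
            _ ≤ _ := by
                rw [← Finset.mul_sum]
                exact mul_le_mul_of_nonneg_left (hvs j _ (Finset.notMem_erase j F))
                  (norm_nonneg _)
        have h7 := norm_sub_le_norm_add (a j * f (v j) (z j)) (∑ i ∈ F.erase j, a i * f (v j) (z i))
        have h8 := mul_le_mul_of_nonneg_right (hy (v j)) (norm_nonneg (a j))
        linarith
      linarith
    have h9 : ‖a‖ ≤ (‖T' a‖ + ‖a‖ * (c / 2)) / c := by
      refine (BoundedContinuousFunction.norm_le (f := a.toBCF) (by positivity)).2 fun j => ?_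
      rw [le_div_iff₀ hc, mul_comm]
      exact h1 j
    rw [le_div_iff₀ hc] at h9
    linarith
  have hanti : AntilipschitzWith (Real.toNNReal (c / 2)⁻¹) T' := by
    refine AddMonoidHomClass.antilipschitz_of_bound T' fun a => ?_
    rw [Real.coe_toNNReal _ (by positivity), inv_mul_eq_div, le_div_iff₀ (by positivity), mul_comm]
    exact hlow a
  exact ⟨_, ⟨T'.equivRange hanti.injective (hanti.isClosed_range T'.uniformContinuous)⟩⟩

end BessagaPelczynski

/-! ### The Cauchy criterion and summability -/

section Convergence

variable {ι Ω : Type*} [MeasurableSpace Ω] {r : ι → Ω → ℝ} {μ : Measure Ω} [IsProbabilityMeasure μ]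
  {𝕜 : Type*} [RCLike 𝕜] {X : Type*} [NormedAddCommGroup X] [NormedSpace 𝕜 X]

theorem signSum_map {κ : Type*} (x : ι → X) (e : κ ↪ ι) (F : Finset κ) (v : ι → ℝ) :
    signSum 𝕜 x (F.map e) v = signSum 𝕜 (fun k => x (e k)) F fun k => v (e k) :=
  Finset.sum_map _ _ _

/-- Hoffmann-Jørgensen–Kwapień: in a Banach space not containing `c₀`, a bounded Rademacher series
satisfies the Cauchy criterion in `L²`. -/
theorem IsSignFamily.exists_forall_disjoint_integral_lt [CompleteSpace X] [Infinite ι]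
    (hX : ¬ ContainsC0 𝕜 X) (hr : IsSignFamily r μ) (x : ι → X) {K δ : ℝ}
    (hK : ∀ F : Finset ι, ∫ ω, ‖signSum 𝕜 x F (fun i => r i ω)‖ ^ 2 ∂μ ≤ K) (hδ : 0 < δ) :
    ∃ G : Finset ι, ∀ F, Disjoint F G →
      ∫ ω, ‖signSum 𝕜 x F (fun i => r i ω)‖ ^ 2 ∂μ < δ := by
  classical
  by_contra! hcon
  obtain ⟨δ', hδ', hL1⟩ := hr.exists_le_integral_norm_signSum x hK hδ hcon
  obtain ⟨F, hF, hd⟩ := exists_seq_of_forall_finset_exists'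
    (fun F : Finset ι => δ' ≤ ∫ ω, ‖signSum 𝕜 x F (fun i => r i ω)‖ ∂μ) Disjoint
    (fun S _ => by
      obtain ⟨F, hFd, hF⟩ := hL1 (S.sup id)
      exact ⟨F, hF, fun T hT => (hFd.mono_right (Finset.le_sup (f := id) hT)).symm⟩)
  -- The freezing signs may be drawn from the same family, since freezing takes place on a product
  -- space.
  have hρ := hr.comp_injective (Infinite.natEmbedding ι).injective
  obtain ⟨z, c, t, hc, hz, ht⟩ := hr.exists_bounded_series_of_blocks x hK hδ' hd hF hρ
  obtain ⟨v, hv, hzv⟩ := Filter.extraction_of_frequently_atTop hz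
  -- Contraction preserves the energy bound along the subsequence of terms bounded below.
  have hbdd : ∀ N, ∫ ω, ‖signSum 𝕜 (fun n => z (v n)) (Finset.range N)
      (fun n => r (Infinite.natEmbedding ι (v n)) ω)‖ ^ 2 ∂μ ≤ t := by
    intro N
    have hsub : (Finset.range N).map ⟨v, hv.injective⟩ ⊆ Finset.range (v N) := by
      intro i hi
      obtain ⟨n, hn, rfl⟩ := Finset.mem_map.1 hi
      exact Finset.mem_range.2 (hv (Finset.mem_range.1 hn))
    refine le_trans (le_of_eq ?_) ((hρ.integral_norm_signSum_sq_mono z hsub).trans (ht (v N)))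
    simp only [signSum_map, Function.Embedding.coeFn_mk]
  obtain ⟨u, C, hC⟩ :=
    (hρ.comp_injective hv.injective).exists_injective_bounded_sign_sums hbdd
  exact hX (containsC0_of_bounded_sign_sums hc (fun i => hzv (u i)) hC)

/-- Every Rademacher family is almost everywhere equal to one with values exactly `±1`. -/
theorem IsRademacherFamily.isSignFamily (hr : IsRademacherFamily r μ) :
    IsSignFamily (fun i ω => if r i ω = 1 then (1 : ℝ) else -1) μ where
  measurable i := Measurable.ite (hr.measurable i (measurableSet_singleton 1))
    measurable_const measurable_const
  indep := hr.indep.comp (fun _ t => if t = 1 then (1 : ℝ) else -1) fun _ =>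
    Measurable.ite (measurableSet_singleton 1) measurable_const measurable_const
  prob_one i := by
    rw [← hr.prob_one i]
    congr 1
    ext ω
    by_cases h : r i ω = 1 <;> norm_num [h]
  prob_neg_one i := by
    rw [← hr.prob_neg_one i]
    refine measure_congr ?_
    filter_upwards [hr.ae_eq_or i] with ω hω
    refine propext ?_
    change (if r i ω = 1 then (1 : ℝ) else -1) = -1 ↔ r i ω = -1
    rcases hω with h | h <;> norm_num [h]
  eq_or i ω := by by_cases h : r i ω = 1 <;> simp [h]

/-- The norm sees only almost-everywhere classes, so the variables may be replaced by exact signs.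
-/
theorem norm_sum_radTensor_sq (hr : IsRademacherFamily r μ) (x : ι → X) (F : Finset ι) :
    ‖∑ k ∈ F, radTensor 𝕜 hr k (x k)‖ ^ 2 =
      ∫ ω, ‖signSum 𝕜 x F (fun k => if r k ω = 1 then (1 : ℝ) else -1)‖ ^ 2 ∂μ := by
  have hcoe : ((∑ k ∈ F, radTensor 𝕜 hr k (x k) : Rad 𝕜 X hr) : Lp X 2 μ) =
      ∑ k ∈ F, radTensorLp 𝕜 hr k (x k) := by
    rw [AddSubmonoidClass.coe_finsetSum]
    rfl
  have hae : (∑ k ∈ F, radTensorLp 𝕜 hr k (x k) : Lp X 2 μ) =ᵐ[μ]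
      fun ω => signSum 𝕜 x F (fun k => if r k ω = 1 then (1 : ℝ) else -1) := by
    refine (Lp.coeFn_finsetSum F _).trans ?_
    have h1 : ∀ᵐ ω ∂μ, ∀ k ∈ F, radTensorLp 𝕜 hr k (x k) ω = (r k ω : 𝕜) • x k :=
      (Filter.eventually_all_finset F).2 fun k _ => (hr.memLp_smul k (x k)).coeFn_toLp
    have h2 : ∀ᵐ ω ∂μ, ∀ k ∈ F, r k ω = 1 ∨ r k ω = -1 :=
      (Filter.eventually_all_finset F).2 fun k _ => hr.ae_eq_or k
    filter_upwards [h1, h2] with ω h1 h2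
    rw [Finset.sum_apply, signSum]
    refine Finset.sum_congr rfl fun k hk => ?_
    rw [h1 k hk]
    rcases h2 k hk with h | h <;> norm_num [h]
  rw [← Submodule.norm_coe, hcoe, Lp.norm_def, toReal_eLpNorm (Lp.aestronglyMeasurable _),
    lpNorm_eq_integral_norm_rpow_toReal (by norm_num) (by norm_num) (Lp.aestronglyMeasurable _)]
  rw [← Real.rpow_natCast, ← Real.rpow_mul (integral_nonneg fun _ => by positivity)]
  simp only [ENNReal.toReal_ofNat, Nat.cast_ofNat]
  rw [inv_mul_cancel₀ two_ne_zero, Real.rpow_one]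
  refine integral_congr_ae ?_
  filter_upwards [hae] with ω hω
  rw [hω, Real.rpow_ofNat]

end Convergence

theorem mainTheorem10 {𝕜 : Type*} [RCLike 𝕜]
    {X : Type*} [NormedAddCommGroup X] [NormedSpace 𝕜 X] [CompleteSpace X]
    (hX : ¬ ContainsC0 𝕜 X)
    {d : ℕ} (hd : 2 ≤ d)
    {Ω : Type*} [MeasurableSpace Ω] {μ : Measure Ω} [IsProbabilityMeasure μ]
    {r : (Fin d → ℕ+) → Ω → ℝ} (hr : IsRademacherFamily r μ)
    (x : (Fin d → ℕ+) → X)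
    (hbdd : ∃ K : ℝ, 0 ≤ K ∧ ∀ N : ℕ+,
      ‖∑ k ∈ Fintype.piFinset (fun _ : Fin d => Finset.Icc 1 N), radTensor 𝕜 hr k (x k)‖ ≤ K) :
    Summable (fun k : Fin d → ℕ+ => radTensor 𝕜 hr k (x k)) := by
  classical
  -- A nonempty `Fin d` makes the index set infinite.
  have : Nonempty (Fin d) := ⟨⟨0, by omega⟩⟩
  have hs := hr.isSignFamily
  obtain ⟨K, hK, hbdd⟩ := hbdd
  have hbdd' : ∀ F : Finset (Fin d → ℕ+),
      ∫ ω, ‖signSum 𝕜 x F (fun k => if r k ω = 1 then (1 : ℝ) else -1)‖ ^ 2 ∂μ ≤ K ^ 2 := by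
    intro F
    -- Every finite index set lies in a cube, where the hypothesis applies.
    obtain ⟨N, hN⟩ : ∃ N : ℕ+, ∀ k ∈ F, ∀ i, k i ≤ N := by
      obtain ⟨g, hg⟩ := F.bddAbove
      obtain ⟨N, hN⟩ := (Finset.univ.image g).bddAbove
      exact ⟨N, fun k hk i => (hg hk i).trans
        (hN (Finset.mem_coe.2 (Finset.mem_image_of_mem g (Finset.mem_univ i))))⟩
    have hsub : F ⊆ Fintype.piFinset fun _ : Fin d => Finset.Icc 1 N := fun k hk =>
      Fintype.mem_piFinset.2 fun i => Finset.mem_Icc.2 ⟨one_le, hN k hk i⟩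
    refine (hs.integral_norm_signSum_sq_mono x hsub).trans ?_
    rw [← norm_sum_radTensor_sq hr]
    exact pow_le_pow_left₀ (norm_nonneg _) (hbdd _) 2
  have : CompleteSpace (Rad 𝕜 X hr) := by unfold Rad; infer_instance
  rw [summable_iff_vanishing_norm]
  intro ε hε
  obtain ⟨G, hG⟩ := hs.exists_forall_disjoint_integral_lt hX x hbdd' (pow_pos hε 2)
  refine ⟨G, fun F hF => ?_⟩
  have := hG F hF
  rw [← norm_sum_radTensor_sq hr] at this
  exact lt_of_pow_lt_pow_left₀ 2 hε.le this
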